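/- All vector inequalities are componentwise. Let $n\ge 0$. System. Let $X_i=\{x\in\mathbb R^n: E_ix+e_i\ge 0\}$, $i\in I$ ($I$ finite), be polyhedra with pairwise disjoint interiors, and for each $i$ let $x\mapsto A_{ik}x+a_{ik}$, $k\in D_i$, be a nonempty finite family of affine fields. Put $\mathrm{Dom}(P)=\bigcup_i X_i$ and $\Omega_P(x)=\mathrm{co}\{A_{ik}x+a_{ik} : x\in X_i,\ k\in D_i\}$ for $x\in\mathrm{Dom}(P)$. Let $\mathcal A$ be any upper semicontinuous set-valued map on $\mathbb R^n$ with nonempty compact convex values such that $\mathcal A(x)=\Omega_P(x)$ for all $x\in \mathrm{Dom}(P)$ (outside $\mathrm{Dom}(P)$ it is otherwise arbitrary). A solution on $[0,T]$ is an absolutely continuous $x:[0,T]\to\mathbb R^n$ with $\dot x(t)\in\mathcal A(x(t))$ for a.e. $t$; a solution on $[0,\infty)$ is one on every $[0,T]$. Candidate Lyapunov function. Let $Z_j=\{x: F_jx\ge 0\}$, $j\in J$ ($J$ finite), be polyhedral cones that contain no line, have pairwise disjoint interiors and cover $\mathbb R^n$. For $i\ne j$ let $f_{ij}$ be a vector with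 $f_{ij}^Tx=0$ on $Z_i\cap Z_j$. Given vectors $p_j$, let $V(x)=p_j^Tx$ if $x\in Z_j$ (under the constraints below this does not depend on the choice of $j$). Let $I_{cont}$ be the set of pairs $(i,j)$, $i\neq j$, such that $Z_i\cap Z_j$ contains a nonzero point, and $I_{dec}$ the set of triples $(i,j,k)$, $k\in D_i$, such that $X_i\cap Z_j$ contains a nonzero point. Level sets. Let $L$ be the set of $c>0$ with $\{V=c\}\subseteq\mathrm{Dom}(P)$. Let $S_{min}=\bigcap_{c\in L}\{V\le c\}$, and let $S_{max}$ be the union of the sets $\{V\le c\}$ over those $c\in L$ for which $[b,c]\subseteq L$ for every $b\in L$ with $b\le c$. (If $L$ is an interval, these are the regions bounded by the largest and by the smallest level set of $V$ in $\mathrm{Dom}(P)$.) Lemma. Let $\mathrm{Dom}(P)$ be connected and let $0\in\mathrm{co}(\mathrm{Dom}(P))$. Suppose that there are vectors $\mu_j$, $v_{ijk}$ and reals $\lambda_{ij}$ such that $$p_j=F_j^T\mu_j,\quad \mu_j\ge\mathbf 1\qquad (j\in J),$$ $$\begin{bmatrix}E_i&e_i\\0&1\end{bmatrix}^Tv_{ijk}=-\begin{bmatrix}A_{ik}^T\\a_{ik}^T\end{bmatrix}p_j,\quad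 v_{ijk}\ge\mathbf 1\qquad ((i,j,k)\in I_{dec}),$$ $$p_i-p_j=\lambda_{ij}f_{ij},\quad \lambda_{ij}\ge 1\qquad((i,j)\in I_{cont}).$$ Then: 1. $S_{max}$ is invariant: every solution on some $[0,T]$ that starts in $S_{max}$ stays in $S_{max}$. 2. $S_{min}$ is an ultimate bound: for every bounded $B\subseteq S_{max}$ there is $\tau\ge 0$ such that every solution on some $[0,T]$ that starts in $B$ satisfies $x(t)\in S_{min}$ for all $t\in[\tau,T]$. 3. If moreover $0$ is an interior point of $\mathrm{Dom}(P)$, then the origin is asymptotically stable with region of attraction containing $S_{max}$: $0\in\mathcal A(0)$; for every neighbourhood $U$ of $0$ there is a neighbourhood $W$ of $0$ such that solutions that start in $W$ stay in $U$; $S_{max}$ is a neighbourhood of $0$; and every solution on $[0,\infty)$ that starts in $S_{max}$ converges to $0$. -/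

import Mathlib

open Set Filter Topology MeasureTheory
open scoped Matrix

namespace PWA

/-- The closed convex polyhedron `{x | E x + e ≥ 0}` (componentwise inequality). -/
def polyhedron {r n : ℕ} (E : Matrix (Fin r) (Fin n) ℝ) (e : Fin r → ℝ) : Set (Fin n → ℝ) :=
  {x | 0 ≤ E *ᵥ x + e}

/-- A piecewise affine differential inclusion on `ℝⁿ`: finitely many polyhedral cells
`X i = {x | E i x + e i ≥ 0}` with pairwise disjoint interiors, and, for each cell, a nonempty
finite family of affine vector fields `x ↦ A i k x + a i k`. The cells need not cover `ℝⁿ`. -/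
structure System (n : ℕ) (ι : Type*) where
  rows : ι → ℕ
  E : ∀ i, Matrix (Fin (rows i)) (Fin n) ℝ
  e : ∀ i, Fin (rows i) → ℝ
  numFields : ι → ℕ
  numFields_pos : ∀ i, 0 < numFields i
  A : ∀ i, Fin (numFields i) → Matrix (Fin n) (Fin n) ℝ
  a : ∀ i, Fin (numFields i) → Fin n → ℝ
  disjoint_interior : ∀ i j, i ≠ j →
    Disjoint (interior (polyhedron (E i) (e i))) (interior (polyhedron (E j) (e j)))

namespace System

variable {n : ℕ} {ι : Type*} (Ω : System n ι)

/-- The cell with index `i`. -/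
def cell (i : ι) : Set (Fin n → ℝ) := polyhedron (Ω.E i) (Ω.e i)

/-- The domain: the union of the cells. -/
def Dom : Set (Fin n → ℝ) := ⋃ i, Ω.cell i

/-- The set of admissible velocities at `x`: the convex hull of the values at `x` of all affine
fields attached to cells that contain `x`. In a point that lies in a single cell `i` this is the
convex hull of the `A i k x + a i k`; where cells meet, it is the usual convexification. -/
def velocities (x : Fin n → ℝ) : Set (Fin n → ℝ) :=
  convexHull ℝ {v | ∃ i, x ∈ Ω.cell i ∧ ∃ k, v = Ω.A i k *ᵥ x + Ω.a i k}

end System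

/-- A finite polyhedral conic partition of `ℝⁿ`: the closed cones `Z j = {x | F j x ≥ 0}` have
pairwise disjoint interiors, contain no line and cover `ℝⁿ`; `f i j` is a normal vector of a
hyperplane through the origin that contains `Z i ∩ Z j`. -/
structure ConePartition (n : ℕ) (κ : Type*) where
  rows : κ → ℕ
  F : ∀ j, Matrix (Fin (rows j)) (Fin n) ℝ
  disjoint_interior : ∀ i j, i ≠ j →
    Disjoint (interior {x | 0 ≤ F i *ᵥ x}) (interior {x | 0 ≤ F j *ᵥ x})
  pointed : ∀ j x, 0 ≤ F j *ᵥ x → 0 ≤ F j *ᵥ (-x) → x = 0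
  cover : ∀ x, ∃ j, 0 ≤ F j *ᵥ x
  f : κ → κ → Fin n → ℝ
  f_orthogonal : ∀ i j, i ≠ j → ∀ x, 0 ≤ F i *ᵥ x → 0 ≤ F j *ᵥ x → f i j ⬝ᵥ x = 0

namespace ConePartition

variable {n : ℕ} {κ : Type*} (Q : ConePartition n κ)

/-- The cone with index `j`. -/
def cone (j : κ) : Set (Fin n → ℝ) := {x | 0 ≤ Q.F j *ᵥ x}

/-- The candidate Lyapunov function `V x = p jᵀ x` for `x` in the cone `j`. (If several cones
contain `x`, one of them is chosen; `lyap_eq` below shows that the choice does not matter under the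
constraints.) -/
noncomputable def lyap (p : κ → Fin n → ℝ) (x : Fin n → ℝ) : ℝ :=
  p (Q.cover x).choose ⬝ᵥ x

end ConePartition

section Constraints

variable {n : ℕ} {ι κ : Type*}

/-- The pairs of distinct cones that share a point other than the common apex `0`. -/
def Icont (Q : ConePartition n κ) : Set (κ × κ) :=
  {q | q.1 ≠ q.2 ∧ ∃ x, x ≠ 0 ∧ x ∈ Q.cone q.1 ∧ x ∈ Q.cone q.2}

/-- The pairs of a cell and a cone that share a point other than the apex `0` of the cones. -/
def Idec (Ω : System n ι) (Q : ConePartition n κ) : Set (ι × κ) :=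
  {q | ∃ x, x ≠ 0 ∧ x ∈ Ω.cell q.1 ∧ x ∈ Q.cone q.2}

/-- The constraint system for the vectors `p j` is feasible: there are multipliers `μ`, `v`, `lam`
with which all constraints hold. -/
def Feasible (Ω : System n ι) (Q : ConePartition n κ) (p : κ → Fin n → ℝ) : Prop :=
  ∃ (μ : ∀ j, Fin (Q.rows j) → ℝ)
    (v : ∀ (i : ι) (_ : κ) (_ : Fin (Ω.numFields i)), Fin (Ω.rows i) ⊕ Unit → ℝ)
    (lam : κ → κ → ℝ),
    (∀ j, p j = (Q.F j)ᵀ *ᵥ μ j) ∧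
    (∀ j, 1 ≤ μ j) ∧
    (∀ i j, (i, j) ∈ Idec Ω Q → ∀ k,
      (Matrix.fromBlocks (Ω.E i) (Matrix.replicateCol Unit (Ω.e i)) 0 1)ᵀ *ᵥ v i j k =
        -(Matrix.fromRows (Ω.A i k)ᵀ (Matrix.replicateRow Unit (Ω.a i k)) *ᵥ p j)) ∧
    (∀ i j, (i, j) ∈ Idec Ω Q → ∀ k, 1 ≤ v i j k) ∧
    (∀ i j, (i, j) ∈ Icont Q → p i - p j = lam i j • Q.f i j) ∧
    (∀ i j, (i, j) ∈ Icont Q → 1 ≤ lam i j)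

/-- Under the constraints, `V x = p jᵀ x` for every cone `j` that contains `x`. -/
theorem lyap_eq {Ω : System n ι} {Q : ConePartition n κ} {p : κ → Fin n → ℝ}
    (h : Feasible Ω Q p) {j : κ} {x : Fin n → ℝ} (hx : x ∈ Q.cone j) :
    Q.lyap p x = p j ⬝ᵥ x := by
  obtain ⟨μ, v, lam, -, -, -, -, hc, -⟩ := h
  unfold ConePartition.lyap
  have hi := (Q.cover x).choose_spec
  set i := (Q.cover x).choose
  by_cases hij : i = j
  · rw [hij]
  by_cases h0 : x = 0
  · simp [h0]
  have h1 := hc i j ⟨hij, x, h0, hi, hx⟩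
  have h2 := Q.f_orthogonal i j hij x hi hx
  have h3 : (p i - p j) ⬝ᵥ x = 0 := by rw [h1, smul_dotProduct, h2, smul_zero]
  rw [sub_dotProduct] at h3
  linarith

/-- The positive levels `c` of `V` such that the level set `{V = c}` lies in the domain. -/
def levels (Ω : System n ι) (Q : ConePartition n κ) (p : κ → Fin n → ℝ) : Set ℝ :=
  {c | 0 < c ∧ {x | Q.lyap p x = c} ⊆ Ω.Dom}

/-- The region `S_min` bounded by the smallest level set of `V` in the domain: the intersection of
all `{V ≤ c}` with `c` a level in the domain. It is `{0}` if all small levels are in the domain. -/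
def Smin (Ω : System n ι) (Q : ConePartition n κ) (p : κ → Fin n → ℝ) : Set (Fin n → ℝ) :=
  {x | ∀ c ∈ levels Ω Q p, Q.lyap p x ≤ c}

/-- The region `S_max` bounded by the largest level set of `V` in the domain: the union of the sets
`{V ≤ c}` with `c` a level in the domain such that there is no gap below `c`, i.e. all values
between a smaller level in the domain and `c` are also levels in the domain. (It is everything if
arbitrarily large `c` qualify.) -/
def Smax (Ω : System n ι) (Q : ConePartition n κ) (p : κ → Fin n → ℝ) : Set (Fin n → ℝ) :=
  {x | ∃ c ∈ levels Ω Q p, Q.lyap p x ≤ c ∧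
    ∀ b ∈ levels Ω Q p, b ≤ c → Icc b c ⊆ levels Ω Q p}

end Constraints

section Inclusions

variable {n : ℕ}

/-- The standing regularity of a differential inclusion on `ℝⁿ`: the right-hand side is upper
semicontinuous (as a set-valued map) with nonempty compact convex values. -/
structure IsRegularInclusion (𝒜 : (Fin n → ℝ) → Set (Fin n → ℝ)) : Prop where
  nonempty : ∀ x, (𝒜 x).Nonempty
  isCompact : ∀ x, IsCompact (𝒜 x)
  convex : ∀ x, Convex ℝ (𝒜 x)
  usc : UpperHemicontinuous 𝒜

/-- A Caratheodory solution of `x' ∈ 𝒜 x` on `[0, T]`. -/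
def IsSolution (𝒜 : (Fin n → ℝ) → Set (Fin n → ℝ)) (x : ℝ → Fin n → ℝ) (T : ℝ) : Prop :=
  AbsolutelyContinuousOnInterval x 0 T ∧
    ∀ᵐ t ∂(volume : Measure ℝ), t ∈ Ioo 0 T → ∃ v ∈ 𝒜 (x t), HasDerivAt x v t

/-- `S` is (strongly, forward) invariant: solutions that start in `S` stay in `S`. -/
def IsInvariant (𝒜 : (Fin n → ℝ) → Set (Fin n → ℝ)) (S : Set (Fin n → ℝ)) : Prop :=
  ∀ T, 0 ≤ T → ∀ x, IsSolution 𝒜 x T → x 0 ∈ S → ∀ t ∈ Icc 0 T, x t ∈ S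

/-- Solutions from `S` are ultimately bounded by `M`: for every bounded set `B ⊆ S` there is a
time after which all solutions that started in `B` are in `M`. -/
def IsUltimatelyBounded (𝒜 : (Fin n → ℝ) → Set (Fin n → ℝ)) (S M : Set (Fin n → ℝ)) : Prop :=
  ∀ B ⊆ S, Bornology.IsBounded B → ∃ τ : ℝ, 0 ≤ τ ∧
    ∀ T, 0 ≤ T → ∀ x, IsSolution 𝒜 x T → x 0 ∈ B → ∀ t ∈ Icc τ T, x t ∈ M

/-- The point `z` is an asymptotically stable equilibrium of `x' ∈ 𝒜 x` whose region of attraction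
contains the neighbourhood `S` of `z`. -/
structure IsAsymptoticallyStable (𝒜 : (Fin n → ℝ) → Set (Fin n → ℝ)) (z : Fin n → ℝ)
    (S : Set (Fin n → ℝ)) : Prop where
  equilibrium : 0 ∈ 𝒜 z
  stable : ∀ U ∈ 𝓝 z, ∃ W ∈ 𝓝 z, ∀ T, 0 ≤ T → ∀ x, IsSolution 𝒜 x T → x 0 ∈ W →
    ∀ t ∈ Icc 0 T, x t ∈ U
  mem_nhds : S ∈ 𝓝 z
  attractive : ∀ x : ℝ → Fin n → ℝ, (∀ T, 0 ≤ T → IsSolution 𝒜 x T) → x 0 ∈ S →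
    Tendsto x atTop (𝓝 z)

end Inclusions

end PWA

/-!
Near a point `x`, the increment of a piecewise linear `V` is that of a piece active at `x`, so along
a solution the derivative of `V` is almost everywhere the slope of an active piece in the direction
of an admissible velocity. Pairing the constraint on `v i j k` with the vector `(x, 1)` bounds these
slopes by `-1` at all nonzero points of the domain. By upper semicontinuity they stay negative near
a level set of `V` in the domain, hence no solution can leave the sublevel set. Between a level
`b` in the domain and the starting level `V` decreases at unit rate, so that a solution is below `b`
at the latest at time `V (x 0)`.

The origin is an equilibrium: otherwise a linear functional `ξ` is positive on `𝒜 0`, hence on `𝒜`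
over a small sublevel set of `V`. At a maximiser of `ξ` over this compact set the admissible
velocities do not leave the set to first order, so `ξ` cannot be positive on them.
-/

namespace PWA

theorem forall_mem_Icc_le_of_eventually_nhdsGT {α β : Type*} [ConditionallyCompleteLinearOrder α]
    [DenselyOrdered α] [TopologicalSpace α] [OrderTopology α] [LinearOrder β] [TopologicalSpace β]
    [OrderClosedTopology β] {g : α → β} {a b : α} {c : β} (hg : ContinuousOn g (Icc a b))
    (ha : g a ≤ c) (h : ∀ t ∈ Ico a b, g t = c → ∀ᶠ s in 𝓝[>] t, g s ≤ c) :
    ∀ t ∈ Icc a b, g t ≤ c := by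
  have hclosed : IsClosed ({t | g t ≤ c} ∩ Icc a b) := by
    rw [inter_comm]
    exact hg.preimage_isClosed_of_isClosed isClosed_Icc isClosed_Iic
  refine hclosed.Icc_subset_of_forall_mem_nhdsWithin ha fun t ⟨(htc : g t ≤ c), ht⟩ => ?_
  rcases htc.lt_or_eq with hlt | heq
  · have hgt : Tendsto g (𝓝[>] t) (𝓝 (g t)) :=
      (hg t (Ico_subset_Icc_self ht)).mono_left (nhdsWithin_le_of_mem (Icc_mem_nhdsGT_of_mem ht))
    filter_upwards [hgt.eventually_lt_const hlt] with s hs using hs.le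
  · exact h t ht heq

theorem sub_le_mul_sub_of_ae_deriv_le {g : ℝ → ℝ} {a b δ : ℝ} (hab : a ≤ b)
    (hg : AbsolutelyContinuousOnInterval g a b) (h : ∀ᵐ t, t ∈ Ioo a b → deriv g t ≤ δ) :
    g b - g a ≤ δ * (b - a) := by
  have hae : deriv g ≤ᵐ[volume.restrict (Icc a b)] fun _ => δ := by
    rw [← Measure.restrict_congr_set Ioo_ae_eq_Icc]
    exact (ae_restrict_iff' measurableSet_Ioo).2 h
  calc g b - g a = ∫ t in a..b, deriv g t := hg.integral_deriv_eq_sub.symm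
    _ ≤ ∫ _ in a..b, δ := intervalIntegral.integral_mono_ae_restrict hab
        hg.intervalIntegrable_deriv intervalIntegrable_const hae
    _ = δ * (b - a) := by rw [intervalIntegral.integral_const, smul_eq_mul, mul_comm]

theorem absolutelyContinuousOnInterval_comp_of_lipschitzWith {X Y : Type*} [PseudoMetricSpace X]
    [PseudoMetricSpace Y] {f : X → Y} {K : NNReal} (hf : LipschitzWith K f) {x : ℝ → X} {a b : ℝ}
    (hx : AbsolutelyContinuousOnInterval x a b) :
    AbsolutelyContinuousOnInterval (f ∘ x) a b := by
  refine squeeze_zero (fun _ => Finset.sum_nonneg fun _ _ => dist_nonneg) (fun I => ?_)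
    (by simpa only [mul_zero] using Tendsto.const_mul (K : ℝ) hx)
  rw [Finset.mul_sum]
  exact Finset.sum_le_sum fun _ _ => hf.dist_le_mul _ _

section NormedSpace

variable {E : Type*} [NormedAddCommGroup E] {V : E → ℝ}

theorem isCompact_sublevel_of_mul_norm_le [ProperSpace E] (hV : Continuous V) {α : ℝ} (hα : 0 < α)
    (hle : ∀ x, α * ‖x‖ ≤ V x) (c : ℝ) : IsCompact {x | V x ≤ c} := by
  refine (isCompact_closedBall 0 (c / α)).of_isClosed_subset (isClosed_le hV continuous_const)
    fun x (hx : V x ≤ c) => ?_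
  rw [mem_closedBall_zero_iff, le_div_iff₀' hα]
  exact (hle x).trans hx

theorem hasBasis_nhds_zero_sublevel_of_mul_norm_le (hV : ContinuousAt V 0) (hzero : V 0 = 0)
    {α : ℝ} (hα : 0 < α) (hle : ∀ x, α * ‖x‖ ≤ V x) :
    (𝓝 (0 : E)).HasBasis (0 < ·) fun c => {x | V x ≤ c} := by
  refine Metric.nhds_basis_closedBall.to_hasBasis' (fun ε hε => ⟨ε * α, by positivity, ?_⟩)
    fun c hc => ?_
  · intro x (hx : V x ≤ ε * α)
    rw [mem_closedBall_zero_iff]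
    exact le_of_mul_le_mul_left ((hle x).trans (hx.trans_eq (mul_comm ε α))) hα
  · filter_upwards [hV.eventually_lt_const (hzero.trans_lt hc)] with x hx using hx.le

variable [NormedSpace ℝ E]

theorem lipschitzWith_of_eventually_sub_le {K : NNReal} (hV : Continuous V)
    (h : ∀ x, ∀ᶠ y in 𝓝 x, V y - V x ≤ K * dist y x) : LipschitzWith K V := by
  refine LipschitzWith.of_le_add_mul K fun y x => ?_
  set γ : ℝ →ᵃ[ℝ] E := AffineMap.lineMap x y with hγ
  have hγc : Continuous γ := AffineMap.lineMap_continuous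
  have hseg : ∀ ⦃t⦄, t ∈ Icc (0 : ℝ) 1 → V (γ t) ≤ V x + K * dist y x * t := by
    refine image_le_of_liminf_slope_right_le_deriv_boundary (B' := fun _ => K * dist y x)
      (hV.comp hγc).continuousOn (by simp [hγ]) (by fun_prop) (fun t _ => ?_) (fun t _ r hr => ?_)
    · simpa using (((hasDerivAt_id t).const_mul (K * dist y x)).const_add (V x)).hasDerivWithinAt
    · refine Eventually.frequently ?_
      filter_upwards [nhdsWithin_le_nhds (hγc.continuousAt.eventually (h (γ t))),
        self_mem_nhdsWithin] with s hs (hts : t < s)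
      have hts' : 0 < s - t := sub_pos.2 hts
      rw [slope_def_field, div_lt_iff₀ hts']
      calc V (γ s) - V (γ t) ≤ K * dist (γ s) (γ t) := hs
        _ = K * dist y x * (s - t) := by
          rw [hγ, dist_lineMap_lineMap, Real.dist_eq, abs_of_pos hts', dist_comm x y]; ring
        _ < r * (s - t) := mul_lt_mul_of_pos_right hr hts'
  simpa [hγ] using hseg (right_mem_Icc.2 zero_le_one)

theorem exists_mul_norm_le_of_homogeneous [ProperSpace E] (hV : Continuous V)
    (hsmul : ∀ c : ℝ, 0 < c → ∀ x, V (c • x) = c * V x) (hpos : ∀ x, x ≠ 0 → 0 < V x) :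
    ∃ α > 0, ∀ x, α * ‖x‖ ≤ V x := by
  obtain ⟨α, hα, hle⟩ := (isCompact_sphere (0 : E) 1).exists_forall_le' hV.continuousOn
    fun x hx => hpos x (ne_zero_of_mem_unit_sphere ⟨x, hx⟩)
  refine ⟨α, hα, fun x => ?_⟩
  rcases eq_or_ne x 0 with rfl | hx
  · have hzero := hsmul 2 two_pos 0
    rw [smul_zero] at hzero
    rw [norm_zero, mul_zero]
    linarith
  · have hn : 0 < ‖x‖ := norm_pos_iff.2 hx
    have hunit : α ≤ V (‖x‖⁻¹ • x) := hle _ (by simp [norm_smul, hn.ne'])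
    rwa [hsmul _ (inv_pos.2 hn), inv_mul_eq_div, le_div_iff₀ hn] at hunit

/-- `V` is continuous piecewise linear: it coincides with the linear functional `ℓ j` on the closed
set `Z j`, and these sets cover the space. They may overlap, and the piece `j` is called active at
`x` if `x ∈ Z j`. -/
structure IsPiecewiseLinear {κ : Type*} (Z : κ → Set E) (ℓ : κ → E →L[ℝ] ℝ) (V : E → ℝ) :
    Prop where
  isClosed : ∀ j, IsClosed (Z j)
  exists_mem : ∀ x, ∃ j, x ∈ Z j
  eq_apply : ∀ j, ∀ x ∈ Z j, V x = ℓ j x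

namespace IsPiecewiseLinear

variable {κ : Type*} [Finite κ] {Z : κ → Set E} {ℓ : κ → E →L[ℝ] ℝ}

theorem eventually_mem_imp_mem (hV : IsPiecewiseLinear Z ℓ V) (x : E) :
    ∀ᶠ y in 𝓝 x, ∀ j, y ∈ Z j → x ∈ Z j :=
  (locallyFinite_of_finite Z).eventually_subset hV.isClosed x

theorem eventually_sub_eq (hV : IsPiecewiseLinear Z ℓ V) (x : E) :
    ∀ᶠ y in 𝓝 x, ∃ j, x ∈ Z j ∧ V y - V x = ℓ j (y - x) := by
  filter_upwards [hV.eventually_mem_imp_mem x] with y hy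
  obtain ⟨j, hj⟩ := hV.exists_mem y
  exact ⟨j, hy j hj, by rw [hV.eq_apply j y hj, hV.eq_apply j x (hy j hj), map_sub]⟩

theorem exists_lipschitzWith (hV : IsPiecewiseLinear Z ℓ V) : ∃ K, LipschitzWith K V := by
  obtain ⟨K, hK⟩ : ∃ K, ∀ j, ‖ℓ j‖₊ ≤ K :=
    (finite_range fun j => ‖ℓ j‖₊).bddAbove.imp fun K hK j => hK (mem_range_self j)
  have hloc (x : E) : ∀ᶠ y in 𝓝 x, dist (V y) (V x) ≤ K * dist y x := by
    filter_upwards [hV.eventually_sub_eq x] with y ⟨j, _, hj⟩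
    rw [Real.dist_eq, hj, dist_eq_norm]
    exact (ℓ j).le_of_opNorm_le (hK j) _
  have hcont : Continuous V := continuous_iff_continuousAt.2 fun x => by
    obtain ⟨r, hr, hball⟩ := Metric.eventually_nhds_iff.1 (hloc x)
    exact continuousAt_of_locally_lipschitz hr K fun y hy => hball hy
  exact ⟨K, lipschitzWith_of_eventually_sub_le hcont fun x =>
    (hloc x).mono fun _ hy => (le_abs_self _).trans hy⟩

theorem continuous (hV : IsPiecewiseLinear Z ℓ V) : Continuous V :=
  hV.exists_lipschitzWith.choose_spec.continuous

theorem exists_deriv_comp_eq (hV : IsPiecewiseLinear Z ℓ V) {x : ℝ → E} {w : E} {t : ℝ}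
    (hx : HasDerivAt x w t) (hd : DifferentiableAt ℝ (V ∘ x) t) :
    ∃ j, x t ∈ Z j ∧ deriv (V ∘ x) t = ℓ j w := by
  have hslope : ∀ᶠ s in 𝓝[≠] t, ∃ j, x t ∈ Z j ∧ slope (V ∘ x) t s = ℓ j (slope x t s) := by
    filter_upwards [nhdsWithin_le_nhds (hx.continuousAt.eventually (hV.eventually_sub_eq (x t)))]
      with s ⟨j, hj, hjs⟩
    exact ⟨j, hj, by simp only [slope_def_module, Function.comp_apply, hjs, map_smul]⟩
  obtain ⟨j, hfreq⟩ := frequently_exists.1 hslope.frequently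
  exact ⟨j, hfreq.exists.choose_spec.1, tendsto_nhds_unique_of_frequently_eq
    (hasDerivAt_iff_tendsto_slope.1 hd.hasDerivAt)
    (((ℓ j).continuous.tendsto w).comp (hasDerivAt_iff_tendsto_slope.1 hx))
    (hfreq.mono fun _ hs => hs.2)⟩

theorem comp_sub_le_mul_sub (hV : IsPiecewiseLinear Z ℓ V) {x : ℝ → E} {a b δ : ℝ} (hab : a ≤ b)
    (hx : AbsolutelyContinuousOnInterval x a b)
    (h : ∀ᵐ t, t ∈ Ioo a b → ∃ w, HasDerivAt x w t ∧ ∀ j, x t ∈ Z j → ℓ j w ≤ δ) :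
    V (x b) - V (x a) ≤ δ * (b - a) := by
  obtain ⟨K, hK⟩ := hV.exists_lipschitzWith
  have hVx : AbsolutelyContinuousOnInterval (V ∘ x) a b :=
    absolutelyContinuousOnInterval_comp_of_lipschitzWith hK hx
  refine sub_le_mul_sub_of_ae_deriv_le hab hVx ?_
  filter_upwards [hVx.ae_differentiableAt, h] with t hd hw ht
  obtain ⟨w, hder, hδ⟩ := hw ht
  obtain ⟨j, hj, hderiv⟩ :=
    hV.exists_deriv_comp_eq hder (hd (uIcc_of_le hab ▸ Ioo_subset_Icc_self ht))
  exact hderiv.trans_le (hδ j hj)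

end IsPiecewiseLinear

end NormedSpace

section Matrices

variable {R m n : Type*} [Fintype m]

theorem dotProduct_pos_of_forall_pos [Semiring R] [PartialOrder R] [IsStrictOrderedRing R]
    {u v : m → R} (hu : ∀ i, 0 < u i) (hv : 0 < v) : 0 < u ⬝ᵥ v := by
  obtain ⟨hnonneg, i, hi⟩ := Pi.lt_def.1 hv
  exact Finset.sum_pos' (fun k _ => mul_nonneg (hu k).le (hnonneg k))
    ⟨i, Finset.mem_univ i, mul_pos (hu i) hi⟩

theorem one_le_dotProduct_sumElim_one [Semiring R] [PartialOrder R] [IsOrderedRing R]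
    {v : m ⊕ Unit → R} (hv : 1 ≤ v) {y : m → R} (hy : 0 ≤ y) : 1 ≤ v ⬝ᵥ Sum.elim y 1 := by
  have hinl : 0 ≤ ∑ i, v (Sum.inl i) * y i :=
    Finset.sum_nonneg fun i _ => mul_nonneg (zero_le_one.trans (hv _)) (hy i)
  calc (1 : R) ≤ v (Sum.inr ()) := hv _
    _ ≤ (∑ i, v (Sum.inl i) * y i) + v (Sum.inr ()) := le_add_of_nonneg_left hinl
    _ = v ⬝ᵥ Sum.elim y 1 := by simp [dotProduct]

theorem fromBlocks_replicateCol_mulVec_sumElim_one [NonAssocSemiring R] (E : Matrix n m R)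
    (e : n → R) (x : m → R) :
    Matrix.fromBlocks E (Matrix.replicateCol Unit e) 0 (1 : Matrix Unit Unit R) *ᵥ
        Sum.elim x 1 =
      Sum.elim (E *ᵥ x + e) 1 := by
  have hcol : Matrix.replicateCol Unit e *ᵥ (1 : Unit → R) = e := by
    ext i; simp [Matrix.mulVec, dotProduct]
  rw [Matrix.fromBlocks_mulVec, Sum.elim_comp_inl, Sum.elim_comp_inr, hcol, Matrix.zero_mulVec,
    Matrix.one_mulVec, zero_add]

theorem fromRows_replicateRow_mulVec_dotProduct_sumElim_one [CommSemiring R] [Fintype n]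
    (A : Matrix n m R) (a p : n → R) (x : m → R) :
    (Matrix.fromRows Aᵀ (Matrix.replicateRow Unit a) *ᵥ p) ⬝ᵥ Sum.elim x 1 =
      p ⬝ᵥ (A *ᵥ x + a) := by
  have hrow : (Matrix.replicateRow Unit a *ᵥ p) ⬝ᵥ (1 : Unit → R) = p ⬝ᵥ a := by
    simp [Matrix.replicateRow_mulVec_eq_const, dotProduct_comm]
  rw [Matrix.fromRows_mulVec, sumElim_dotProduct_sumElim, hrow, Matrix.mulVec_transpose,
    ← Matrix.dotProduct_mulVec, dotProduct_add]

/-- The easy half of the affine Farkas lemma: pair the certificate with the vector `(x, 1)`. -/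
theorem dotProduct_affine_le_neg_one [CommRing R] [PartialOrder R] [IsOrderedRing R] [Fintype n]
    {r : Type*} [Fintype r] {E : Matrix r m R} {e : r → R} {A : Matrix n m R} {a p : n → R}
    {v : r ⊕ Unit → R} (hv : 1 ≤ v)
    (hcert : (Matrix.fromBlocks E (Matrix.replicateCol Unit e) 0 1)ᵀ *ᵥ v =
      -(Matrix.fromRows Aᵀ (Matrix.replicateRow Unit a) *ᵥ p))
    {x : m → R} (hx : 0 ≤ E *ᵥ x + e) : p ⬝ᵥ (A *ᵥ x + a) ≤ -1 := by
  have hpair : v ⬝ᵥ Sum.elim (E *ᵥ x + e) 1 = -(p ⬝ᵥ (A *ᵥ x + a)) := by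
    rw [← fromBlocks_replicateCol_mulVec_sumElim_one, Matrix.dotProduct_mulVec,
      ← Matrix.mulVec_transpose, hcert, neg_dotProduct,
      fromRows_replicateRow_mulVec_dotProduct_sumElim_one]
  exact le_neg_of_le_neg (hpair ▸ one_le_dotProduct_sumElim_one hv hx)

/-- The linear functional `x ↦ p ⬝ᵥ x`, bundled as a continuous linear map, the form in which
`IsPiecewiseLinear` takes its pieces. -/
noncomputable def dotProductCLM (p : m → ℝ) : (m → ℝ) →L[ℝ] ℝ :=
  LinearMap.toContinuousLinearMap (dotProductBilin ℝ ℝ p)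

@[simp]
theorem dotProductCLM_apply (p x : m → ℝ) : dotProductCLM p x = p ⬝ᵥ x := rfl

end Matrices

section Lyapunov

variable {n : ℕ} {ι κ : Type*} {Ω : System n ι} {Q : ConePartition n κ} {p : κ → Fin n → ℝ}

theorem ConePartition.isClosed_cone (Q : ConePartition n κ) (j : κ) : IsClosed (Q.cone j) :=
  isClosed_le continuous_const (Continuous.matrix_mulVec continuous_const continuous_id)

theorem ConePartition.smul_mem_cone {j : κ} {x : Fin n → ℝ} (hx : x ∈ Q.cone j) {c : ℝ}
    (hc : 0 ≤ c) : c • x ∈ Q.cone j := by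
  have hmul : 0 ≤ c • (Q.F j *ᵥ x) := smul_nonneg hc hx
  rwa [← Matrix.mulVec_smul] at hmul

theorem ConePartition.mulVec_pos (Q : ConePartition n κ) {j : κ} {x : Fin n → ℝ}
    (hx : x ∈ Q.cone j) (hx0 : x ≠ 0) : 0 < Q.F j *ᵥ x := by
  refine lt_of_le_of_ne hx fun hzero => hx0 (Q.pointed j x hx ?_)
  rw [Matrix.mulVec_neg, ← hzero, neg_zero]

theorem IsSolution.continuousOn {𝒜 : (Fin n → ℝ) → Set (Fin n → ℝ)} {x : ℝ → Fin n → ℝ} {T : ℝ}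
    (hx : IsSolution 𝒜 x T) (hT : 0 ≤ T) : ContinuousOn x (Icc 0 T) :=
  uIcc_of_le hT ▸ hx.1.continuousOn

namespace Feasible

theorem isPiecewiseLinear_lyap (h : Feasible Ω Q p) :
    IsPiecewiseLinear Q.cone (fun j => dotProductCLM (p j)) (Q.lyap p) where
  isClosed := Q.isClosed_cone
  exists_mem := Q.cover
  eq_apply _ _ hx := lyap_eq h hx

theorem lyap_zero (h : Feasible Ω Q p) : Q.lyap p 0 = 0 := by
  obtain ⟨j, hj⟩ := Q.cover 0
  rw [lyap_eq h hj, dotProduct_zero]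

theorem lyap_smul (h : Feasible Ω Q p) {c : ℝ} (hc : 0 ≤ c) (x : Fin n → ℝ) :
    Q.lyap p (c • x) = c * Q.lyap p x := by
  obtain ⟨j, hj⟩ := Q.cover x
  rw [lyap_eq h hj, lyap_eq h (Q.smul_mem_cone hj hc), dotProduct_smul, smul_eq_mul]

theorem lyap_pos (h : Feasible Ω Q p) {x : Fin n → ℝ} (hx : x ≠ 0) : 0 < Q.lyap p x := by
  obtain ⟨j, hj⟩ := Q.cover x
  rw [lyap_eq h hj]
  obtain ⟨μ, -, -, hp, hμ, -⟩ := h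
  rw [hp j, Matrix.mulVec_transpose, ← Matrix.dotProduct_mulVec]
  exact dotProduct_pos_of_forall_pos (fun r => one_pos.trans_le (hμ j r)) (Q.mulVec_pos hj hx)

theorem ne_zero_of_lyap_pos (h : Feasible Ω Q p) {x : Fin n → ℝ} (hx : 0 < Q.lyap p x) :
    x ≠ 0 := by
  rintro rfl
  exact hx.ne' h.lyap_zero

theorem dotProduct_velocity_le (h : Feasible Ω Q p) {x w : Fin n → ℝ} (hx : x ≠ 0) {j : κ}
    (hj : x ∈ Q.cone j) (hw : w ∈ Ω.velocities x) : p j ⬝ᵥ w ≤ -1 := by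
  obtain ⟨-, v, -, -, -, hcert, hv, -⟩ := h
  have hconv : Convex ℝ {w | p j ⬝ᵥ w ≤ -1} :=
    convex_halfSpace_le ((dotProductCLM (p j)).toLinearMap.isLinear) _
  refine convexHull_min ?_ hconv hw
  rintro _ ⟨i, hi, k, rfl⟩
  have hij : (i, j) ∈ Idec Ω Q := ⟨x, hx, hi, hj⟩
  exact dotProduct_affine_le_neg_one (hv i j hij k) (hcert i j hij k) hi

variable [Finite κ]

theorem continuous_lyap (h : Feasible Ω Q p) : Continuous (Q.lyap p) :=
  h.isPiecewiseLinear_lyap.continuous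

theorem exists_mul_norm_le_lyap (h : Feasible Ω Q p) : ∃ α > 0, ∀ x, α * ‖x‖ ≤ Q.lyap p x :=
  exists_mul_norm_le_of_homogeneous h.continuous_lyap (fun _ hc => h.lyap_smul hc.le)
    fun _ => h.lyap_pos

theorem isCompact_sublevel_lyap (h : Feasible Ω Q p) (c : ℝ) : IsCompact {x | Q.lyap p x ≤ c} := by
  obtain ⟨α, hα, hle⟩ := h.exists_mul_norm_le_lyap
  exact isCompact_sublevel_of_mul_norm_le h.continuous_lyap hα hle c

theorem hasBasis_nhds_zero_sublevel_lyap (h : Feasible Ω Q p) :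
    (𝓝 (0 : Fin n → ℝ)).HasBasis (0 < ·) fun c => {x | Q.lyap p x ≤ c} := by
  obtain ⟨α, hα, hle⟩ := h.exists_mul_norm_le_lyap
  exact hasBasis_nhds_zero_sublevel_of_mul_norm_le h.continuous_lyap.continuousAt h.lyap_zero hα hle

theorem exists_Ioc_subset_levels (h : Feasible Ω Q p) (h0 : 0 ∈ interior Ω.Dom) :
    ∃ c > 0, Ioc 0 c ⊆ levels Ω Q p := by
  obtain ⟨c, hc, hsub⟩ :=
    h.hasBasis_nhds_zero_sublevel_lyap.mem_iff.1 (mem_interior_iff_mem_nhds.1 h0)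
  exact ⟨c, hc, fun b hb => ⟨hb.1, fun y (hy : Q.lyap p y = b) => hsub (hy.trans_le hb.2)⟩⟩

theorem Smin_eq_singleton (h : Feasible Ω Q p) (h0 : 0 ∈ interior Ω.Dom) : Smin Ω Q p = {0} := by
  obtain ⟨c, hc, hcsub⟩ := h.exists_Ioc_subset_levels h0
  refine Subset.antisymm (fun y hy => ?_) ?_
  · by_contra hy0
    have hpos := h.lyap_pos hy0
    have hle : Q.lyap p y ≤ min c (Q.lyap p y / 2) :=
      hy _ (hcsub ⟨lt_min hc (half_pos hpos), min_le_left _ _⟩)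
    exact (half_lt_self hpos).not_ge (hle.trans (min_le_right _ _))
  · rintro _ rfl b hb
    exact h.lyap_zero.trans_le hb.1.le

theorem Smax_mem_nhds (h : Feasible Ω Q p) (h0 : 0 ∈ interior Ω.Dom) : Smax Ω Q p ∈ 𝓝 0 := by
  obtain ⟨c, hc, hcsub⟩ := h.exists_Ioc_subset_levels h0
  filter_upwards [h.hasBasis_nhds_zero_sublevel_lyap.mem_of_mem hc] with y hy
  exact ⟨c, hcsub ⟨hc, le_rfl⟩, hy, fun b hb _ =>
    (Icc_subset_Ioc hb.1 le_rfl).trans hcsub⟩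

variable {𝒜 : (Fin n → ℝ) → Set (Fin n → ℝ)} {x : ℝ → Fin n → ℝ} {T : ℝ}

theorem lyap_sub_le_mul_sub (h : Feasible Ω Q p) (hx : IsSolution 𝒜 x T) {a b δ : ℝ}
    (ha : 0 ≤ a) (hab : a ≤ b) (hb : b ≤ T)
    (hδ : ∀ t ∈ Ioo a b, ∀ w ∈ 𝒜 (x t), ∀ j, x t ∈ Q.cone j → p j ⬝ᵥ w ≤ δ) :
    Q.lyap p (x b) - Q.lyap p (x a) ≤ δ * (b - a) := by
  refine h.isPiecewiseLinear_lyap.comp_sub_le_mul_sub hab (hx.1.mono ?_) ?_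
  · rw [uIcc_of_le hab, uIcc_of_le (ha.trans (hab.trans hb))]
    exact Icc_subset_Icc ha hb
  · filter_upwards [hx.2] with t hsol ht
    obtain ⟨w, hw, hder⟩ := hsol ⟨ha.trans_lt ht.1, ht.2.trans_le hb⟩
    exact ⟨w, hder, hδ t ht w hw⟩

theorem eventually_dotProduct_neg (h : Feasible Ω Q p) {y : Fin n → ℝ} (hy : y ≠ 0)
    (husc : UpperHemicontinuousAt 𝒜 y) (hsub : 𝒜 y ⊆ Ω.velocities y) :
    ∀ᶠ z in 𝓝 y, ∀ w ∈ 𝒜 z, ∀ j, z ∈ Q.cone j → p j ⬝ᵥ w < 0 := by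
  have hopen : IsOpen {w | ∀ j, y ∈ Q.cone j → p j ⬝ᵥ w < 0} := by
    simp only [ofPred_forall]
    exact isOpen_iInter_of_finite fun j => isOpen_iInter_of_finite fun _ =>
      isOpen_lt (dotProductCLM (p j)).continuous continuous_const
  filter_upwards [husc.forall_isOpen _ hopen fun w hw j hj =>
      (h.dotProduct_velocity_le hy hj (hsub hw)).trans_lt neg_one_lt_zero,
    h.isPiecewiseLinear_lyap.eventually_mem_imp_mem y] with z hneg hcone w hw j hj
  exact hneg hw j (hcone j hj)

theorem eventually_lyap_le (h : Feasible Ω Q p) (hx : IsSolution 𝒜 x T) {t : ℝ} (ht : t ∈ Ico 0 T)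
    (hxt : x t ≠ 0) (husc : UpperHemicontinuousAt 𝒜 (x t))
    (hsub : 𝒜 (x t) ⊆ Ω.velocities (x t)) :
    ∀ᶠ s in 𝓝[>] t, Q.lyap p (x s) ≤ Q.lyap p (x t) := by
  have hcont : Tendsto x (𝓝[>] t) (𝓝 (x t)) :=
    (hx.continuousOn (ht.1.trans ht.2.le) t (Ico_subset_Icc_self ht)).mono_left
      (nhdsWithin_le_of_mem (Icc_mem_nhdsGT_of_mem ht))
  obtain ⟨u, hu, hneg⟩ := (mem_nhdsGT_iff_exists_Ioo_subset' ht.2).1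
    (hcont.eventually (h.eventually_dotProduct_neg hxt husc hsub))
  filter_upwards [Ioo_mem_nhdsGT (lt_min hu ht.2)] with s ⟨hts, hsu⟩
  have hdec := h.lyap_sub_le_mul_sub hx ht.1 hts.le (hsu.le.trans (min_le_right _ _)) (δ := 0)
    fun r hr w hw j hj => (hneg ⟨hr.1, hr.2.trans (hsu.trans_le (min_le_left _ _))⟩ w hw j hj).le
  linarith

theorem lyap_le_of_mem_levels (h : Feasible Ω Q p)
    (husc : ∀ y ∈ Ω.Dom, UpperHemicontinuousAt 𝒜 y) (hsub : ∀ y ∈ Ω.Dom, 𝒜 y ⊆ Ω.velocities y)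
    (hx : IsSolution 𝒜 x T) {c : ℝ} (hc : c ∈ levels Ω Q p) {s t : ℝ} (hs : 0 ≤ s) (hst : s ≤ t)
    (ht : t ≤ T) (hxs : Q.lyap p (x s) ≤ c) : Q.lyap p (x t) ≤ c := by
  have hcont : ContinuousOn (Q.lyap p ∘ x) (Icc s t) := h.continuous_lyap.comp_continuousOn
    ((hx.continuousOn (hs.trans (hst.trans ht))).mono (Icc_subset_Icc hs ht))
  refine forall_mem_Icc_le_of_eventually_nhdsGT hcont hxs
    (fun r hr (hrc : Q.lyap p (x r) = c) => ?_) t (right_mem_Icc.2 hst)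
  have hD : x r ∈ Ω.Dom := hc.2 hrc
  simpa only [Function.comp_apply, hrc] using h.eventually_lyap_le hx
    ⟨hs.trans hr.1, hr.2.trans_le ht⟩ (h.ne_zero_of_lyap_pos (hc.1.trans_eq hrc.symm)) (husc _ hD)
    (hsub _ hD)

theorem isInvariant_Smax (h : Feasible Ω Q p) (husc : ∀ y ∈ Ω.Dom, UpperHemicontinuousAt 𝒜 y)
    (hsub : ∀ y ∈ Ω.Dom, 𝒜 y ⊆ Ω.velocities y) : IsInvariant 𝒜 (Smax Ω Q p) := by
  rintro T - x hx ⟨c, hc, hxc, hgap⟩ t ht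
  exact ⟨c, hc, h.lyap_le_of_mem_levels husc hsub hx hc le_rfl ht.1 ht.2 hxc, hgap⟩

theorem mem_Smin_of_lyap_initial_le (h : Feasible Ω Q p)
    (husc : ∀ y ∈ Ω.Dom, UpperHemicontinuousAt 𝒜 y) (hsub : ∀ y ∈ Ω.Dom, 𝒜 y ⊆ Ω.velocities y)
    (hx : IsSolution 𝒜 x T) (hx0 : x 0 ∈ Smax Ω Q p) {t : ℝ} (ht : t ∈ Icc 0 T)
    (hVt : Q.lyap p (x 0) ≤ t) : x t ∈ Smin Ω Q p := by
  intro b hb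
  obtain ⟨c, hc, hxc, hgap⟩ := hx0
  by_contra! hlt
  have hlev : ∀ s ∈ Icc 0 t, Q.lyap p (x s) ∈ levels Ω Q p := by
    have hle : ∀ s ∈ Icc 0 t, Q.lyap p (x s) ≤ c := fun s hs =>
      h.lyap_le_of_mem_levels husc hsub hx hc le_rfl hs.1 (hs.2.trans ht.2) hxc
    have hge : ∀ s ∈ Icc 0 t, b ≤ Q.lyap p (x s) := fun s hs => by
      by_contra! hsb
      exact hlt.not_ge (h.lyap_le_of_mem_levels husc hsub hx hb hs.1 hs.2 ht.2 hsb.le)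
    have hbc : b ≤ c := hlt.le.trans (hle t (right_mem_Icc.2 ht.1))
    exact fun s hs => hgap b hb hbc ⟨hge s hs, hle s hs⟩
  have hdec : Q.lyap p (x t) - Q.lyap p (x 0) ≤ -1 * (t - 0) := by
    refine h.lyap_sub_le_mul_sub hx le_rfl ht.1 ht.2 fun s hs w hw j hj => ?_
    have hs' := hlev s (Ioo_subset_Icc_self hs)
    exact h.dotProduct_velocity_le (h.ne_zero_of_lyap_pos hs'.1) hj (hsub _ (hs'.2 rfl) hw)
  linarith [hb.1]

theorem isUltimatelyBounded (h : Feasible Ω Q p) (husc : ∀ y ∈ Ω.Dom, UpperHemicontinuousAt 𝒜 y)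
    (hsub : ∀ y ∈ Ω.Dom, 𝒜 y ⊆ Ω.velocities y) :
    IsUltimatelyBounded 𝒜 (Smax Ω Q p) (Smin Ω Q p) := by
  intro B hB hBb
  obtain ⟨K, hK⟩ := h.isPiecewiseLinear_lyap.exists_lipschitzWith
  obtain ⟨M, hM⟩ := (hK.isBounded_image hBb).bddAbove
  refine ⟨max M 0, le_max_right _ _, fun T _ x hx hx0 t ht => ?_⟩
  exact h.mem_Smin_of_lyap_initial_le husc hsub hx (hB hx0) ⟨(le_max_right _ _).trans ht.1, ht.2⟩
    ((hM (mem_image_of_mem _ hx0)).trans ((le_max_left _ _).trans ht.1))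

theorem eventually_lyap_add_smul_le (h : Feasible Ω Q p) {c : ℝ} (hc : 0 < c) {y w : Fin n → ℝ}
    (hy : Q.lyap p y ≤ c) (hw : w ∈ Ω.velocities y) :
    ∀ᶠ r in 𝓝[>] (0 : ℝ), Q.lyap p (y + r • w) ≤ c := by
  have hray : Tendsto (fun r : ℝ => y + r • w) (𝓝[>] 0) (𝓝 y) :=
    tendsto_nhdsWithin_of_tendsto_nhds (Continuous.tendsto' (by fun_prop) _ _ (by simp))
  rcases hy.lt_or_eq with hlt | heq
  · filter_upwards [((h.continuous_lyap.tendsto y).comp hray).eventually_lt_const hlt] with r hr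
      using hr.le
  · have hy0 : y ≠ 0 := h.ne_zero_of_lyap_pos (hc.trans_eq heq.symm)
    filter_upwards [hray.eventually (h.isPiecewiseLinear_lyap.eventually_sub_eq y),
      self_mem_nhdsWithin] with r ⟨j, hj, hjr⟩ (hr : 0 < r)
    rw [add_sub_cancel_left, map_smul, dotProductCLM_apply, smul_eq_mul] at hjr
    have hneg : p j ⬝ᵥ w ≤ 0 := (h.dotProduct_velocity_le hy0 hj hw).trans neg_one_lt_zero.le
    linarith [mul_nonpos_of_nonneg_of_nonpos hr.le hneg]

theorem exists_lyap_le_forall_velocities_apply_nonpos (h : Feasible Ω Q p)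
    (ξ : (Fin n → ℝ) →L[ℝ] ℝ) {c : ℝ} (hc : 0 < c) :
    ∃ y, Q.lyap p y ≤ c ∧ ∀ w ∈ Ω.velocities y, ξ w ≤ 0 := by
  obtain ⟨y, hy, hmax⟩ := (h.isCompact_sublevel_lyap c).exists_isMaxOn
    ⟨0, h.lyap_zero.trans_le hc.le⟩ ξ.continuous.continuousOn
  refine ⟨y, hy, fun w hw => ?_⟩
  obtain ⟨r, hVr, hr : 0 < r⟩ :=
    ((h.eventually_lyap_add_smul_le hc hy hw).and self_mem_nhdsWithin).exists
  have hle : ξ (y + r • w) ≤ ξ y := hmax hVr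
  rw [map_add, map_smul, smul_eq_mul, add_le_iff_nonpos_right] at hle
  exact nonpos_of_mul_nonpos_right hle hr

theorem zero_mem (h : Feasible Ω Q p) (husc : UpperHemicontinuousAt 𝒜 0)
    (hsub : ∀ y ∈ Ω.Dom, 𝒜 y ⊆ Ω.velocities y) (h0 : 0 ∈ interior Ω.Dom)
    (hne : ∀ y ∈ Ω.Dom, (𝒜 y).Nonempty) (hconv : Convex ℝ (𝒜 0)) (hclosed : IsClosed (𝒜 0)) :
    (0 : Fin n → ℝ) ∈ 𝒜 0 := by
  by_contra hnot
  obtain ⟨ξ, u, hu, hsep⟩ := geometric_hahn_banach_point_closed hconv hclosed hnot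
  rw [map_zero] at hu
  have hpos : ∀ᶠ y in 𝓝 0, 𝒜 y ⊆ {w | 0 < ξ w} :=
    husc.forall_isOpen _ (isOpen_lt continuous_const ξ.continuous) fun w hw => hu.trans (hsep w hw)
  obtain ⟨c, hc, hcsub⟩ := h.hasBasis_nhds_zero_sublevel_lyap.mem_iff.1
    (hpos.and (mem_interior_iff_mem_nhds.1 h0))
  obtain ⟨y, hy, hξ⟩ := h.exists_lyap_le_forall_velocities_apply_nonpos ξ hc
  obtain ⟨hypos, hyD⟩ := hcsub hy
  obtain ⟨w, hw⟩ := hne y hyD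
  exact (hξ w (hsub y hyD hw)).not_gt (hypos hw)

theorem isAsymptoticallyStable (h : Feasible Ω Q p)
    (husc : ∀ y ∈ Ω.Dom, UpperHemicontinuousAt 𝒜 y) (hsub : ∀ y ∈ Ω.Dom, 𝒜 y ⊆ Ω.velocities y)
    (h0 : 0 ∈ interior Ω.Dom) (hne : ∀ y ∈ Ω.Dom, (𝒜 y).Nonempty) (hconv : Convex ℝ (𝒜 0))
    (hclosed : IsClosed (𝒜 0)) : IsAsymptoticallyStable 𝒜 0 (Smax Ω Q p) where
  equilibrium := h.zero_mem (husc 0 (interior_subset h0)) hsub h0 hne hconv hclosed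
  stable U hU := by
    obtain ⟨c, hc, hcsub⟩ := h.exists_Ioc_subset_levels h0
    obtain ⟨d, hd, hdU⟩ := h.hasBasis_nhds_zero_sublevel_lyap.mem_iff.1 hU
    have hlev : min c d ∈ levels Ω Q p := hcsub ⟨lt_min hc hd, min_le_left _ _⟩
    refine ⟨{y | Q.lyap p y ≤ min c d},
      h.hasBasis_nhds_zero_sublevel_lyap.mem_of_mem (lt_min hc hd), fun T _ x hx hx0 t ht => hdU ?_⟩
    exact (h.lyap_le_of_mem_levels husc hsub hx hlev le_rfl ht.1 ht.2 hx0).trans (min_le_right _ _)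
  mem_nhds := h.Smax_mem_nhds h0
  attractive x hx hx0 := by
    refine tendsto_const_nhds.congr' ?_
    filter_upwards [eventually_ge_atTop (max 0 (Q.lyap p (x 0)))] with t ht
    have ht0 : 0 ≤ t := (le_max_left _ _).trans ht
    have hmin : x t ∈ Smin Ω Q p := h.mem_Smin_of_lyap_initial_le husc hsub (hx t ht0) hx0
      ⟨ht0, le_rfl⟩ ((le_max_right _ _).trans ht)
    rw [h.Smin_eq_singleton h0] at hmin
    exact hmin.symm

end Feasible

end Lyapunov

end PWA

theorem mainTheorem1_general {n : ℕ} {ι κ : Type*} [Finite κ] (Ω : PWA.System n ι)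
    (Q : PWA.ConePartition n κ) (p : κ → Fin n → ℝ) (hfeas : PWA.Feasible Ω Q p)
    (𝒜 : (Fin n → ℝ) → Set (Fin n → ℝ)) (husc : ∀ x ∈ Ω.Dom, UpperHemicontinuousAt 𝒜 x)
    (hsub : ∀ x ∈ Ω.Dom, 𝒜 x ⊆ Ω.velocities x) :
    PWA.IsInvariant 𝒜 (PWA.Smax Ω Q p) ∧
    PWA.IsUltimatelyBounded 𝒜 (PWA.Smax Ω Q p) (PWA.Smin Ω Q p) ∧
    ((0 : Fin n → ℝ) ∈ interior Ω.Dom → (∀ x ∈ Ω.Dom, (𝒜 x).Nonempty) → Convex ℝ (𝒜 0) →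
      IsClosed (𝒜 0) →
      PWA.IsAsymptoticallyStable 𝒜 0 (PWA.Smax Ω Q p)) :=
  ⟨hfeas.isInvariant_Smax husc hsub, hfeas.isUltimatelyBounded husc hsub,
    hfeas.isAsymptoticallyStable husc hsub⟩

theorem mainTheorem1 {n : ℕ} {ι κ : Type*} [Finite ι] [Finite κ]
    (Ω : PWA.System n ι) (Q : PWA.ConePartition n κ) (p : κ → Fin n → ℝ)
    (hconn : IsConnected Ω.Dom) (hco : (0 : Fin n → ℝ) ∈ convexHull ℝ Ω.Dom)
    (hfeas : PWA.Feasible Ω Q p)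
    (𝒜 : (Fin n → ℝ) → Set (Fin n → ℝ)) (hreg : PWA.IsRegularInclusion 𝒜)
    (hΩ : ∀ x ∈ Ω.Dom, 𝒜 x = Ω.velocities x) :
    PWA.IsInvariant 𝒜 (PWA.Smax Ω Q p) ∧
    PWA.IsUltimatelyBounded 𝒜 (PWA.Smax Ω Q p) (PWA.Smin Ω Q p) ∧
    ((0 : Fin n → ℝ) ∈ interior Ω.Dom →
      PWA.IsAsymptoticallyStable 𝒜 0 (PWA.Smax Ω Q p)) := by
  obtain ⟨hinv, hub, hstable⟩ := mainTheorem1_general Ω Q p hfeas 𝒜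
    (fun x _ => hreg.usc.upperHemicontinuousAt x) fun x hx => (hΩ x hx).subset
  exact ⟨hinv, hub, fun h0 => hstable h0 (fun x _ => hreg.nonempty x) (hreg.convex 0)
    (hreg.isCompact 0).isClosed⟩
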